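/- Proposition 1. Let $N,M,K$ be positive integers, let $H_F\in\mathbb{C}^{K\times N}$ and $H_B\in\mathbb{C}^{M\times K}$ be nonzero matrices, let $\sigma_n^2>0$ be the noise power and $P\ge 0$ the total transmit power. Let $\sigma_{F1}\ge\sigma_{F2}\ge\dots\ge 0$ and $\sigma_{B1}\ge\sigma_{B2}\ge\dots\ge 0$ be the ordered singular values of $H_F$ and $H_B$ (zero singular values included; the sequences are continued by zeros beyond the sizes of the matrices). Consider $$C=\max_{Q,\Phi}\ \log\det\Bigl(I_M+\tfrac1{\sigma_n^2}\,H_B\Phi H_F\,Q\,(H_B\Phi H_F)^\dagger\Bigr),$$ where $Q\in\mathbb{C}^{N\times N}$ ranges over the positive semidefinite matrices with $\operatorname{tr}Q\le P$ and $\Phi\in\mathbb{C}^{K\times K}$ over all unitary matrices, not necessarily diagonal. For $\mu\in\mathbb{R}$ put $$P_i=\max\Bigl(0,\ \mu-\frac{\sigma_n^2}{\sigma_{Fi}^2\sigma_{Bi}^2}\Bigr)\quad\text{if }\sigma_{Fi}\sigma_{Bi}\neq 0,\qquad P_i=0\quad\text{if }\sigma_{Fi}\sigma_{Bi}=0 .$$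 Then there is a $\mu$ with $\sum_{i=1}^{\min(N,M)}P_i=P$, and for every such $\mu$ the following holds. The maximum exists and equals $$C=\sum_{i=1}^{\min(N,M)}\log\Bigl(1+\sigma_{Fi}^2\sigma_{Bi}^2\,\frac{P_i}{\sigma_n^2}\Bigr).$$ Moreover, for all singular value decompositions $H_F=U_F\Sigma_FV_F^\dagger$ and $H_B=U_B\Sigma_BV_B^\dagger$ (with square unitary factors, and with the ordered singular values on the main diagonals of the rectangular matrices $\Sigma_F\in\mathbb{C}^{K\times N}$ and $\Sigma_B\in\mathbb{C}^{M\times K}$), the maximum is attained at $$\Phi=V_BU_F^\dagger,\qquad Q=V_F\,\operatorname{diag}\{P_1,\dots,P_N\}\,V_F^\dagger .$$ -/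

import Mathlib

open scoped Matrix ComplexOrder

namespace RISMIMO

/-- The ordered singular values of a complex matrix, in decreasing order and with multiplicity.
The indices start at `0`; the sequence is continued by zeros beyond the size of the matrix. -/
noncomputable def singularValue {m n : ℕ} (A : Matrix (Fin m) (Fin n) ℂ) (i : ℕ) : ℝ :=
  (Matrix.toEuclideanLin A).singularValues i

/-- The rectangular `m × n` matrix `diag {v 0, v 1, …}`. -/
def rectDiag (m n : ℕ) (v : ℕ → ℝ) : Matrix (Fin m) (Fin n) ℂ :=
  Matrix.of fun i j => if (i : ℕ) = (j : ℕ) then ((v i : ℝ) : ℂ) else 0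

/-- `U` and `V` are matrices of left and of right singular vectors of `A`: both are unitary and
`A = U Σ V†`, where `Σ` carries the ordered singular values of `A` on its main diagonal. -/
def IsSVD {m n : ℕ} (A : Matrix (Fin m) (Fin n) ℂ)
    (U : Matrix (Fin m) (Fin m) ℂ) (V : Matrix (Fin n) (Fin n) ℂ) : Prop :=
  U ∈ Matrix.unitaryGroup (Fin m) ℂ ∧ V ∈ Matrix.unitaryGroup (Fin n) ℂ ∧
    A = U * rectDiag m n (singularValue A) * Vᴴ

/-- The rate `log det (I + H Q H† / σn ^ 2)` of the channel `y = H x + n` with input covariance `Q`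
and noise power `σn ^ 2`. For positive semidefinite `Q` the determinant is a real number `≥ 1`. -/
noncomputable def rate {M N : ℕ} (σn : ℝ) (H : Matrix (Fin M) (Fin N) ℂ)
    (Q : Matrix (Fin N) (Fin N) ℂ) : ℝ :=
  Real.log (1 + (((σn ^ 2)⁻¹ : ℝ) : ℂ) • (H * Q * Hᴴ)).det.re

/-- The constraints of the capacity problem: `Q ⪰ 0`, `tr Q ≤ P`, and `Φ` is unitary. -/
def Feasible {N K : ℕ} (P : ℝ) (Q : Matrix (Fin N) (Fin N) ℂ)
    (Φ : Matrix (Fin K) (Fin K) ℂ) : Prop :=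
  Q.PosSemidef ∧ Q.trace.re ≤ P ∧ Φ ∈ Matrix.unitaryGroup (Fin K) ℂ

/-- The rates of the end-to-end channel `H_B Φ H_F` over all feasible `Q` and `Φ`. -/
def achievableRates {N M K : ℕ} (σn P : ℝ) (HF : Matrix (Fin K) (Fin N) ℂ)
    (HB : Matrix (Fin M) (Fin K) ℂ) : Set ℝ :=
  {r | ∃ (Q : Matrix (Fin N) (Fin N) ℂ) (Φ : Matrix (Fin K) (Fin K) ℂ),
    Feasible P Q Φ ∧ r = rate σn (HB * Φ * HF) Q}

/-- The squared product of the `i`-th singular values of the two channels. -/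
noncomputable def gain {N M K : ℕ} (HF : Matrix (Fin K) (Fin N) ℂ)
    (HB : Matrix (Fin M) (Fin K) ℂ) (i : ℕ) : ℝ :=
  singularValue HF i ^ 2 * singularValue HB i ^ 2

/-- The water-filling power `(μ - σn ^ 2 / gain i)⁺` at level `μ`. A mode of zero gain gets no
power (there `σn ^ 2 / gain i` is read as `+∞`). -/
noncomputable def waterPower {N M K : ℕ} (σn : ℝ) (HF : Matrix (Fin K) (Fin N) ℂ)
    (HB : Matrix (Fin M) (Fin K) ℂ) (μ : ℝ) (i : ℕ) : ℝ :=
  if gain HF HB i = 0 then 0 else max 0 (μ - σn ^ 2 / gain HF HB i)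

/-- The covariance `V diag {P 0, P 1, …} V†`. -/
noncomputable def covariance {N : ℕ} (V : Matrix (Fin N) (Fin N) ℂ) (p : ℕ → ℝ) :
    Matrix (Fin N) (Fin N) ℂ :=
  V * Matrix.diagonal (fun j : Fin N => ((p j : ℝ) : ℂ)) * Vᴴ

end RISMIMO

/-! Factor `Q = S Sᴴ` and let `A = H_B Φ H_F S`. The rate is the sum of `log (1 + σ_i(A)² / σn²)`.
By Horn's inequality (`prod_singularValue_sq_le`), for each `k ≤ N` the product of the `k` largest
`σ_i(A)²` is at most that of the `gain i * σ_i(S)²`; the unitary `Φ` drops out. Since `t ↦ log (1 +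
exp t)` is convex and increasing, this weak log-majorization passes to the sums
(`sum_log_one_add_le_of_prod_le`). With `q i = σ_i(S)²`, whose sum is `tr Q`, what remains is power
allocation over parallel modes, solved by water-filling (`sum_log_le_sum_log_waterFill`). Aligned
singular bases attain the bound (`rate_covariance`).

Horn's inequality rests on Gram determinants: Cauchy–Binet shows that a matrix scales the Gram
determinant of `k` vectors by at most the product of its `k` largest squared singular values, with
equality at its leading right singular vectors. -/

namespace RISMIMO

/-! ### Weak log-majorization -/

/-- Partial summation: a sum with nonnegative partial sums stays nonnegative when it is weighted
by a decreasing nonnegative sequence. -/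
theorem mul_sum_range_le_sum_range_mul {w a : ℕ → ℝ} (hw : Antitone w) (n : ℕ)
    (ha : ∀ k ≤ n, 0 ≤ ∑ i ∈ Finset.range k, a i) :
    w n * ∑ i ∈ Finset.range n, a i ≤ ∑ i ∈ Finset.range n, w i * a i := by
  induction n with
  | zero => simp
  | succ n ih =>
    have h1 := ih fun k hk => ha k (hk.trans n.le_succ)
    have h2 : w (n + 1) * ∑ i ∈ Finset.range (n + 1), a i ≤
        w n * ∑ i ∈ Finset.range (n + 1), a i :=
      mul_le_mul_of_nonneg_right (hw n.le_succ) (ha _ le_rfl)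
    rw [Finset.sum_range_succ] at h2 ⊢
    rw [Finset.sum_range_succ]
    linarith [mul_add (w n) (∑ i ∈ Finset.range n, a i) (a n)]

/-- Tangent line of the convex function `t ↦ log (1 + exp t)` at `t = log x`, where the slope is `x
/ (1 + x)`. It follows from concavity of `log` between `1` and `y / x`. -/
theorem log_one_add_sub_log_one_add_ge {x y : ℝ} (hx : 0 < x) (hy : 0 < y) :
    x / (1 + x) * (Real.log y - Real.log x) ≤ Real.log (1 + y) - Real.log (1 + x) := by
  have hx1 : 0 < 1 + x := by linarith
  have h := strictConcaveOn_log_Ioi.concaveOn.2 (show (1 : ℝ) ∈ Set.Ioi 0 by simp)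
    (Set.mem_Ioi.2 (div_pos hy hx)) (show 0 ≤ 1 / (1 + x) by positivity)
    (show 0 ≤ x / (1 + x) by positivity) (by field_simp)
  have e : 1 / (1 + x) * 1 + x / (1 + x) * (y / x) = (1 + y) / (1 + x) := by field_simp
  simp only [smul_eq_mul, Real.log_one, mul_zero, zero_add] at h
  rw [e, Real.log_div hy.ne' hx.ne', Real.log_div (by linarith) hx1.ne'] at h
  exact h

/-- Weak log-majorization is turned into an inequality of sums by the function `log (1 + ·)`. -/
theorem sum_log_one_add_le_of_prod_le {x y : ℕ → ℝ} (hx : Antitone x) (hx0 : ∀ i, 0 ≤ x i)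
    (hy0 : ∀ i, 0 ≤ y i) (n : ℕ)
    (h : ∀ k ≤ n, ∏ i ∈ Finset.range k, x i ≤ ∏ i ∈ Finset.range k, y i) :
    ∑ i ∈ Finset.range n, Real.log (1 + x i) ≤ ∑ i ∈ Finset.range n, Real.log (1 + y i) := by
  induction n with
  | zero => simp
  | succ n ih =>
    -- A vanishing last `x n` has no logarithm, but its term contributes `log 1 = 0` and can be
    -- dropped.
    rcases (hx0 n).eq_or_lt with hn | hn
    · rw [Finset.sum_range_succ, Finset.sum_range_succ, ← hn]
      have h1 := ih fun k hk => h k (hk.trans n.le_succ)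
      have h2 : 0 ≤ Real.log (1 + y n) := Real.log_nonneg (by linarith [hy0 n])
      simpa using add_le_add h1 h2
    · have hxp : ∀ i ∈ Finset.range (n + 1), 0 < x i := fun i hi =>
        hn.trans_le (hx (Nat.lt_succ_iff.1 (Finset.mem_range.1 hi)))
      have hyp : ∀ i ∈ Finset.range (n + 1), 0 < y i := by
        have hp := (Finset.prod_pos hxp).trans_le (h _ le_rfl)
        exact fun i hi => (hy0 i).lt_of_ne' (Finset.prod_ne_zero_iff.1 hp.ne' i hi)
      -- The tangent slopes decrease along with `x`, so they can serve as weights in the partial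
      -- summation.
      have hw : Antitone fun i => x i / (1 + x i) := fun i j hij => by
        have := hx0 j
        have := hx0 i
        have := hx hij
        change x j / (1 + x j) ≤ x i / (1 + x i)
        rw [div_le_div_iff₀ (by linarith) (by linarith)]
        nlinarith
      have ha : ∀ k ≤ n + 1, 0 ≤ ∑ i ∈ Finset.range k, (Real.log (y i) - Real.log (x i)) := by
        intro k hk
        have hsub : Finset.range k ⊆ Finset.range (n + 1) := Finset.range_subset_range.2 hk
        rw [Finset.sum_sub_distrib, ← Real.log_prod fun i hi => (hyp i (hsub hi)).ne',
          ← Real.log_prod fun i hi => (hxp i (hsub hi)).ne', sub_nonneg]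
        exact Real.log_le_log (Finset.prod_pos fun i hi => hxp i (hsub hi)) (h k hk)
      have h1 := mul_sum_range_le_sum_range_mul hw (n + 1) ha
      have h2 : 0 ≤ x (n + 1) / (1 + x (n + 1)) *
          ∑ i ∈ Finset.range (n + 1), (Real.log (y i) - Real.log (x i)) :=
        mul_nonneg (div_nonneg (hx0 _) (by linarith [hx0 (n + 1)])) (ha _ le_rfl)
      have h3 := Finset.sum_le_sum fun i hi =>
        log_one_add_sub_log_one_add_ge (hxp i hi) (hyp i hi)
      rw [Finset.sum_sub_distrib] at h3
      linarith

/-! ### Water-filling -/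

/-- The water-filling allocation at level `μ` over modes of gains `g`. -/
noncomputable def waterFill (s : ℝ) (g : ℕ → ℝ) (μ : ℝ) (i : ℕ) : ℝ :=
  if g i = 0 then 0 else max 0 (μ - s / g i)

theorem waterFill_nonneg (s : ℝ) (g : ℕ → ℝ) (μ : ℝ) (i : ℕ) : 0 ≤ waterFill s g μ i := by
  unfold waterFill
  split_ifs
  · exact le_rfl
  · exact le_max_left _ _

theorem exists_sum_waterFill_eq {s P : ℝ} {g : ℕ → ℝ} {n : ℕ} (hs : 0 < s) (hP : 0 ≤ P)
    (hg : ∀ i, 0 ≤ g i) (hn : 0 < n) (hg0 : 0 < g 0) :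
    ∃ μ, ∑ i ∈ Finset.range n, waterFill s g μ i = P := by
  have hc : Continuous fun μ => ∑ i ∈ Finset.range n, waterFill s g μ i := by
    refine continuous_finsetSum _ fun i _ => ?_
    unfold waterFill
    split_ifs <;> fun_prop
  have h0 : ∑ i ∈ Finset.range n, waterFill s g 0 i = 0 := by
    refine Finset.sum_eq_zero fun i _ => ?_
    unfold waterFill
    split_ifs
    · rfl
    · exact max_eq_left (by have := div_nonneg hs.le (hg i); linarith)
  -- At this level mode `0` alone receives exactly `P`.
  have h1 : P ≤ ∑ i ∈ Finset.range n, waterFill s g (P + s / g 0) i := by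
    refine le_trans ?_ (Finset.single_le_sum (fun i _ => waterFill_nonneg s g _ i)
      (Finset.mem_range.2 hn))
    simp [waterFill, hg0.ne']
  exact mem_range_of_exists_le_of_exists_ge hc ⟨0, h0.trans_le hP⟩ ⟨_, h1⟩

/-- The tangent to the concave rate at the water-filling power `p` has slope `1 / (s / g i + p)`.
This is `1 / μ` on active modes and at most `1 / μ` on inactive ones, where `q - p = q ≥ 0`. Thus
`μ⁻¹` is the Lagrange multiplier. -/
theorem log_sub_log_waterFill_le {s μ q : ℝ} {g : ℕ → ℝ} {i : ℕ} (hs : 0 < s) (hμ : 0 < μ)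
    (hg : 0 ≤ g i) (hq : 0 ≤ q) :
    Real.log (1 + g i * (q / s)) - Real.log (1 + g i * (waterFill s g μ i / s)) ≤
      μ⁻¹ * (q - waterFill s g μ i) := by
  have hp := waterFill_nonneg s g μ i
  rcases hg.eq_or_lt with h0 | h0
  · have : waterFill s g μ i = 0 := by simp [waterFill, ← h0]
    rw [this, ← h0]
    simp only [zero_mul, add_zero, sub_self, sub_zero]
    positivity
  have hdef : waterFill s g μ i = max 0 (μ - s / g i) := by simp [waterFill, h0.ne']
  set p := waterFill s g μ i
  have hX : 0 < 1 + g i * (q / s) := by positivity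
  have hY : 0 < 1 + g i * (p / s) := by positivity
  rw [← Real.log_div hX.ne' hY.ne']
  refine (Real.log_le_sub_one_of_pos (div_pos hX hY)).trans ?_
  have e : (1 + g i * (q / s)) / (1 + g i * (p / s)) - 1 = (q - p) / (s / g i + p) := by
    have : 0 < s / g i + p := by positivity
    have : 0 < s + g i * p := by positivity
    field_simp
    ring
  rw [e, inv_mul_eq_div]
  rcases le_total 0 (μ - s / g i) with h | h
  · rw [max_eq_right h] at hdef
    rw [show s / g i + p = μ by linarith]
  · rw [max_eq_left h] at hdef
    rw [hdef, sub_zero, add_zero]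
    exact div_le_div_of_nonneg_left hq hμ (by linarith)

/-- The water-filling allocation maximizes the sum rate over all allocations of the same power. -/
theorem sum_log_le_sum_log_waterFill {s P μ : ℝ} {g q : ℕ → ℝ} {n : ℕ} (hs : 0 < s)
    (hg : ∀ i, 0 ≤ g i) (hq : ∀ i, 0 ≤ q i) (hqP : ∑ i ∈ Finset.range n, q i ≤ P)
    (hμ : ∑ i ∈ Finset.range n, waterFill s g μ i = P) :
    ∑ i ∈ Finset.range n, Real.log (1 + g i * (q i / s)) ≤
      ∑ i ∈ Finset.range n, Real.log (1 + g i * (waterFill s g μ i / s)) := by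
  -- A level `μ ≤ 0` gives no multiplier, but it is possible only for `P = 0`, where both
  -- allocations vanish.
  rcases lt_or_ge 0 μ with hpos | hneg
  · have h := Finset.sum_le_sum fun i (_ : i ∈ Finset.range n) =>
      log_sub_log_waterFill_le hs hpos (hg i) (hq i)
    rw [Finset.sum_sub_distrib, ← Finset.mul_sum, Finset.sum_sub_distrib, hμ] at h
    have : μ⁻¹ * (∑ i ∈ Finset.range n, q i - P) ≤ 0 :=
      mul_nonpos_of_nonneg_of_nonpos (inv_nonneg.2 hpos.le) (by linarith)
    linarith
  · have hw : ∀ i, waterFill s g μ i = 0 := fun i => by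
      unfold waterFill
      split_ifs
      · rfl
      · exact max_eq_left (by have := div_nonneg hs.le (hg i); linarith)
    have hP : P = 0 := by rw [← hμ]; exact Finset.sum_eq_zero fun i _ => hw i
    refine Finset.sum_le_sum fun i hi => ?_
    have hqi : q i = 0 :=
      le_antisymm (((Finset.single_le_sum (fun i _ => hq i) hi).trans hqP).trans hP.le) (hq i)
    rw [hqi, hw i]

/-! ### Cauchy–Binet and weighted Gram determinants -/

section CauchyBinet

variable {R : Type*} [CommRing R]

theorem det_mul_eq_sum {k n : ℕ} (A : Matrix (Fin k) (Fin n) R) (B : Matrix (Fin n) (Fin k) R) :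
    (A * B).det = ∑ p : Fin k → Fin n, (∏ i, B (p i) i) * (A.submatrix id p).det := by
  simp only [Matrix.det_apply', Matrix.mul_apply, Finset.prod_univ_sum, Finset.mul_sum,
    Fintype.piFinset_univ, Matrix.submatrix_apply, id]
  rw [Finset.sum_comm]
  refine Finset.sum_congr rfl fun p _ => Finset.sum_congr rfl fun σ _ => ?_
  rw [Finset.prod_mul_distrib]
  ring

/-- The Cauchy–Binet formula, summed over all maps instead of over the `k`-element subsets. -/
theorem factorial_mul_det_mul {k n : ℕ} (A : Matrix (Fin k) (Fin n) R)
    (B : Matrix (Fin n) (Fin k) R) :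
    (k.factorial : R) * (A * B).det =
      ∑ p : Fin k → Fin n, (B.submatrix p id).det * (A.submatrix id p).det := by
  -- Replacing `p` by `p ∘ τ` permutes the columns of the minor of `A` and produces the sign;
  -- summing over `τ` then assembles the minor of `B`.
  have h : ∀ τ : Equiv.Perm (Fin k), (A * B).det = ∑ p : Fin k → Fin n,
      ((Equiv.Perm.sign τ : ℤ) : R) * (∏ i, B (p (τ i)) i) * (A.submatrix id p).det := by
    intro τ
    rw [det_mul_eq_sum, ← Equiv.sum_comp (Equiv.arrowCongr τ.symm (Equiv.refl (Fin n)))]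
    refine Finset.sum_congr rfl fun p _ => ?_
    have h1 : A.submatrix id ((Equiv.arrowCongr τ.symm (Equiv.refl (Fin n))) p) =
        (A.submatrix id p).submatrix id τ := by
      ext i j; simp [Equiv.arrowCongr]
    rw [h1, Matrix.det_permute']
    simp only [Equiv.arrowCongr_apply, Equiv.symm_symm, Equiv.coe_refl, Function.comp_apply, id]
    ring
  calc (k.factorial : R) * (A * B).det = ∑ _τ : Equiv.Perm (Fin k), (A * B).det := by
        simp [Fintype.card_perm]
    _ = _ := by
        rw [Finset.sum_congr rfl fun τ _ => h τ, Finset.sum_comm]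
        refine Finset.sum_congr rfl fun p _ => ?_
        rw [← Finset.sum_mul, Matrix.det_apply' (B.submatrix p id)]
        simp

end CauchyBinet

/-- Once the `k` distinct indices are sorted, the `j`-th is at least `j`. -/
theorem prod_injective_le {d : ℕ → ℝ} (hd : Antitone d) (hd0 : ∀ i, 0 ≤ d i) {k : ℕ}
    {p : Fin k → ℕ} (hp : Function.Injective p) :
    ∏ i, d (p i) ≤ ∏ i ∈ Finset.range k, d i := by
  have hcard : (Finset.univ.image p).card = k := by
    rw [Finset.card_image_of_injective _ hp, Finset.card_fin]
  set S := Finset.univ.image p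
  have h1 : ∏ i, d (p i) = ∏ x ∈ S, d x := (Finset.prod_image fun a _ b _ h => hp h).symm
  have h2 : ∏ x ∈ S, d x = ∏ i : Fin k, d (S.orderEmbOfFin hcard i) := by
    rw [← Finset.prod_image (f := d) (g := S.orderEmbOfFin hcard)
      fun a _ b _ h => (S.orderEmbOfFin hcard).injective h, Finset.image_orderEmbOfFin_univ]
  have h3 : ∀ j : ℕ, ∀ hj : j < k, j ≤ S.orderEmbOfFin hcard ⟨j, hj⟩ := by
    intro j
    induction j with
    | zero => simp
    | succ j ih =>
      intro hj
      have := ih (by omega)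
      have hlt : S.orderEmbOfFin hcard ⟨j, by omega⟩ < S.orderEmbOfFin hcard ⟨j + 1, hj⟩ :=
        (S.orderEmbOfFin hcard).strictMono (by simp)
      omega
  rw [h1, h2, ← Fin.prod_univ_eq_prod_range]
  exact Finset.prod_le_prod (fun i _ => hd0 _) fun i _ => hd (h3 i i.2)

theorem factorial_mul_det_conjTranspose_mul_diagonal_mul {n k : ℕ} (d : Fin n → ℝ)
    (W : Matrix (Fin n) (Fin k) ℂ) :
    (k.factorial : ℝ) * (Wᴴ * Matrix.diagonal (fun j => (d j : ℂ)) * W).det.re =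
      ∑ p : Fin k → Fin n, (∏ i, d (p i)) * Complex.normSq (W.submatrix p id).det := by
  have h := factorial_mul_det_mul (Wᴴ * Matrix.diagonal (fun j => (d j : ℂ))) W
  have h1 : ∀ p : Fin k → Fin n,
      ((Wᴴ * Matrix.diagonal (fun j => (d j : ℂ))).submatrix id p).det =
        (∏ i, (d (p i) : ℂ)) * (starRingEnd ℂ) (W.submatrix p id).det := by
    intro p
    have : (Wᴴ * Matrix.diagonal (fun j => (d j : ℂ))).submatrix id p =
        (W.submatrix p id)ᴴ * Matrix.diagonal (fun i => (d (p i) : ℂ)) := by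
      ext i j
      simp [Matrix.mul_diagonal]
    rw [this, Matrix.det_mul, Matrix.det_diagonal, Matrix.det_conjTranspose, mul_comm]
    rfl
  have h2 : (k.factorial : ℂ) * (Wᴴ * Matrix.diagonal (fun j => (d j : ℂ)) * W).det =
      ((∑ p : Fin k → Fin n, (∏ i, d (p i)) * Complex.normSq (W.submatrix p id).det : ℝ) : ℂ) := by
    rw [h]
    push_cast
    refine Finset.sum_congr rfl fun p _ => ?_
    rw [h1, Complex.normSq_eq_conj_mul_self]
    ring
  have h3 := congrArg Complex.re h2
  rwa [Complex.ofReal_re, ← Complex.ofReal_natCast, Complex.re_ofReal_mul] at h3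

theorem det_conjTranspose_mul_diagonal_mul_le {n k : ℕ} {d : ℕ → ℝ} (hd : Antitone d)
    (hd0 : ∀ i, 0 ≤ d i) (W : Matrix (Fin n) (Fin k) ℂ) :
    (Wᴴ * Matrix.diagonal (fun j : Fin n => (d j : ℂ)) * W).det.re ≤
      (∏ i ∈ Finset.range k, d i) * (Wᴴ * W).det.re := by
  have hk : (0 : ℝ) < k.factorial := by exact_mod_cast k.factorial_pos
  -- Unit weights expand the Gram determinant itself into the same nonnegative terms, so the
  -- comparison is termwise; non-injective `p` give minors with a repeated row.
  have h0 := factorial_mul_det_conjTranspose_mul_diagonal_mul (fun _ => 1) W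
  simp only [Complex.ofReal_one, Matrix.diagonal_one, Matrix.mul_one, Finset.prod_const_one,
    one_mul] at h0
  refine le_of_mul_le_mul_left ?_ hk
  rw [factorial_mul_det_conjTranspose_mul_diagonal_mul (fun j : Fin n => d j) W,
    mul_left_comm, h0, Finset.mul_sum]
  refine Finset.sum_le_sum fun p _ => ?_
  by_cases hp : Function.Injective p
  · exact mul_le_mul_of_nonneg_right
      (prod_injective_le hd hd0 (p := fun i => (p i : ℕ)) (Fin.val_injective.comp hp))
      (Complex.normSq_nonneg _)
  · obtain ⟨i, j, hij, hne⟩ : ∃ i j, p i = p j ∧ i ≠ j := by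
      simpa [Function.Injective] using hp
    rw [Matrix.det_zero_of_row_eq hne (by ext l; simp [hij])]
    simp

/-! ### Singular value decomposition and Gram determinants -/

section SingularValues

variable {m n : ℕ}

theorem singularValue_nonneg (A : Matrix (Fin m) (Fin n) ℂ) (i : ℕ) : 0 ≤ singularValue A i :=
  LinearMap.singularValues_nonneg _ i

theorem singularValue_antitone (A : Matrix (Fin m) (Fin n) ℂ) : Antitone (singularValue A) :=
  LinearMap.singularValues_antitone _

theorem singularValue_sq_antitone (A : Matrix (Fin m) (Fin n) ℂ) :
    Antitone fun i => singularValue A i ^ 2 := fun _ _ hij =>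
  pow_le_pow_left₀ (singularValue_nonneg A _) (singularValue_antitone A hij) 2

theorem singularValue_of_cols_le (A : Matrix (Fin m) (Fin n) ℂ) {i : ℕ} (hi : n ≤ i) :
    singularValue A i = 0 :=
  LinearMap.singularValues_of_finrank_le _ (by simpa using hi)

theorem singularValue_of_rows_le (A : Matrix (Fin m) (Fin n) ℂ) {i : ℕ} (hi : m ≤ i) :
    singularValue A i = 0 :=
  (LinearMap.singularValues_eq_zero_iff_le_finrank_range _).2
    (((Submodule.finrank_le _).trans (by simp)).trans hi)

theorem singularValue_zero_pos {A : Matrix (Fin m) (Fin n) ℂ} (hA : A ≠ 0) :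
    0 < singularValue A 0 := by
  refine (singularValue_nonneg A 0).lt_of_ne' fun h => hA ?_
  have h1 : (Matrix.toEuclideanLin A).singularValues = 0 := by
    ext i
    exact le_antisymm ((singularValue_antitone A (Nat.zero_le i)).trans h.le)
      (singularValue_nonneg A i)
  simpa using (LinearMap.singularValues_eq_zero_iff _).1 h1

theorem toMatrix_basisFun_mem_unitaryGroup
    (b : OrthonormalBasis (Fin n) ℂ (EuclideanSpace ℂ (Fin n))) :
    (Matrix.of fun i j => b j i) ∈ Matrix.unitaryGroup (Fin n) ℂ :=
  (EuclideanSpace.basisFun (Fin n) ℂ).toMatrix_orthonormalBasis_mem_unitary b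

/-- An orthonormal eigenbasis of `Aᴴ A` has orthogonal images of norms `σ_j`. The nonzero images,
normalized and completed to an orthonormal basis, are the left singular vectors. -/
theorem exists_isSVD (A : Matrix (Fin m) (Fin n) ℂ) :
    ∃ (U : Matrix (Fin m) (Fin m) ℂ) (V : Matrix (Fin n) (Fin n) ℂ), IsSVD A U V := by
  set T := Matrix.toEuclideanLin A with hT
  have hn : Module.finrank ℂ (EuclideanSpace ℂ (Fin n)) = n := by simp
  set v := T.isSymmetric_adjoint_comp_self.eigenvectorBasis hn with hv
  have hinner : ∀ i j, inner ℂ (T (v i)) (T (v j)) =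
      if i = j then ((singularValue A j ^ 2 : ℝ) : ℂ) else 0 := by
    intro i j
    have h1 : (LinearMap.adjoint T) (T (v j)) = ((singularValue A j ^ 2 : ℝ) : ℂ) • v j := by
      have := T.isSymmetric_adjoint_comp_self.apply_eigenvectorBasis hn j
      rw [← T.sq_singularValues_fin hn j] at this
      exact this
    rw [← LinearMap.adjoint_inner_right, h1, inner_smul_right,
      orthonormal_iff_ite.1 v.orthonormal i j]
    split_ifs <;> simp
  have hzero : ∀ j : Fin n, singularValue A j = 0 → T (v j) = 0 := by
    intro j hj
    have := hinner j j
    rw [if_pos rfl, hj] at this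
    exact (inner_self_eq_zero (𝕜 := ℂ)).1 (this.trans (by simp))
  let w : Fin m → EuclideanSpace ℂ (Fin m) := fun i =>
    if h : (i : ℕ) < n then ((singularValue A i)⁻¹ : ℂ) • T (v ⟨i, h⟩) else 0
  let s : Set (Fin m) := {i | (i : ℕ) < n ∧ singularValue A i ≠ 0}
  have hw : Orthonormal ℂ (s.domRestrict w) := by
    rw [orthonormal_iff_ite]
    rintro ⟨i, hi, hi0⟩ ⟨j, hj, hj0⟩
    simp only [Set.domRestrict_apply, w, dif_pos hi, dif_pos hj, inner_smul_left, inner_smul_right,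
      hinner, Subtype.mk.injEq, Fin.mk.injEq, Fin.val_inj]
    split_ifs with h
    · subst h
      have : (singularValue A i : ℂ) ≠ 0 := by exact_mod_cast hi0
      simp
      field_simp
    · simp
  obtain ⟨u, hu⟩ := hw.exists_orthonormalBasis_extension_of_card_eq (by simp)
  refine ⟨_, _, toMatrix_basisFun_mem_unitaryGroup u, toMatrix_basisFun_mem_unitaryGroup v, ?_⟩
  set U : Matrix (Fin m) (Fin m) ℂ := Matrix.of fun i j => u j i
  set V : Matrix (Fin n) (Fin n) ℂ := Matrix.of fun i j => v j i
  have hV : V * Vᴴ = 1 := Matrix.mem_unitaryGroup_iff.1 (toMatrix_basisFun_mem_unitaryGroup v)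
  have hAV : A * V = U * rectDiag m n (singularValue A) := by
    ext i j
    have h1 : (A * V) i j = T (v j) i := by
      simp [hT, Matrix.toLpLin_apply, Matrix.mul_apply, Matrix.mulVec, dotProduct, V]
    rw [h1]
    simp only [Matrix.mul_apply, rectDiag, Matrix.of_apply, mul_ite, mul_zero]
    by_cases hj : singularValue A j = 0
    · rw [hzero j hj, Finset.sum_eq_zero]
      · rfl
      · intro l _
        split_ifs with h
        · rw [h, hj]; simp
        · rfl
    · have hjm : (j : ℕ) < m := by
        by_contra h
        exact hj (singularValue_of_rows_le A (not_lt.1 h))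
      rw [Finset.sum_eq_single ⟨j, hjm⟩]
      · have hj' : (singularValue A j : ℂ) ≠ 0 := by exact_mod_cast hj
        simp only [if_true, U, Matrix.of_apply]
        rw [hu ⟨j, hjm⟩ ⟨j.2, hj⟩]
        simp only [w, dif_pos j.2, Fin.eta]
        simp
        field_simp
      · intro l _ hl
        rw [if_neg fun h => hl (Fin.ext h)]
      · simp
  rw [← hAV, Matrix.mul_assoc, hV, Matrix.mul_one]

theorem rectDiag_conjTranspose (v : ℕ → ℝ) : (rectDiag m n v)ᴴ = rectDiag n m v := by
  ext i j
  by_cases h : (i : ℕ) = j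
  · simp [rectDiag, h]
  · simp [rectDiag, h, Ne.symm h]

/-- The inner dimension `m` cuts off the diagonal, so `v` must vanish from `m` on. -/
theorem rectDiag_mul {l : ℕ} (v w : ℕ → ℝ) (hv : ∀ i, m ≤ i → v i = 0) :
    rectDiag l m v * rectDiag m n w = rectDiag l n fun i => v i * w i := by
  ext i j
  simp only [rectDiag, Matrix.mul_apply, Matrix.of_apply]
  by_cases hi : (i : ℕ) < m
  · rw [Finset.sum_eq_single ⟨i, hi⟩]
    · simp
    · intro k _ hk
      rw [if_neg fun h => hk (Fin.ext h.symm), zero_mul]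
    · simp
  · rw [Finset.sum_eq_zero]
    · simp [hv i (not_lt.1 hi)]
    · intro k _
      rw [if_neg (by have := k.2; omega), zero_mul]

theorem rectDiag_self (v : ℕ → ℝ) :
    rectDiag n n v = Matrix.diagonal fun j : Fin n => ((v j : ℝ) : ℂ) := by
  ext i j
  simp [rectDiag, Matrix.diagonal_apply, Fin.ext_iff]

variable {A : Matrix (Fin m) (Fin n) ℂ} {U : Matrix (Fin m) (Fin m) ℂ}
  {V : Matrix (Fin n) (Fin n) ℂ}

theorem IsSVD.conjTranspose_mul_left (h : IsSVD A U V) : Uᴴ * U = 1 :=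
  Matrix.mem_unitaryGroup_iff'.1 h.1

theorem IsSVD.mul_conjTranspose_left (h : IsSVD A U V) : U * Uᴴ = 1 :=
  Matrix.mem_unitaryGroup_iff.1 h.1

theorem IsSVD.conjTranspose_mul_right (h : IsSVD A U V) : Vᴴ * V = 1 :=
  Matrix.mem_unitaryGroup_iff'.1 h.2.1

theorem IsSVD.mul_conjTranspose_right (h : IsSVD A U V) : V * Vᴴ = 1 :=
  Matrix.mem_unitaryGroup_iff.1 h.2.1

theorem IsSVD.conjTranspose_mul_self (h : IsSVD A U V) :
    Aᴴ * A = V * Matrix.diagonal (fun j : Fin n => ((singularValue A j ^ 2 : ℝ) : ℂ)) * Vᴴ := by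
  rw [← rectDiag_self fun i => singularValue A i ^ 2]
  simp only [sq]
  rw [← rectDiag_mul (m := m) _ _ fun i hi => singularValue_of_rows_le A hi]
  conv_lhs => rw [h.2.2]
  rw [Matrix.conjTranspose_mul, Matrix.conjTranspose_mul, Matrix.conjTranspose_conjTranspose,
    rectDiag_conjTranspose]
  simp only [Matrix.mul_assoc]
  rw [← Matrix.mul_assoc Uᴴ, h.conjTranspose_mul_left, Matrix.one_mul]

theorem IsSVD.mul_conjTranspose_self (h : IsSVD A U V) :
    A * Aᴴ = U * Matrix.diagonal (fun j : Fin m => ((singularValue A j ^ 2 : ℝ) : ℂ)) * Uᴴ := by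
  rw [← rectDiag_self fun i => singularValue A i ^ 2]
  simp only [sq]
  rw [← rectDiag_mul (m := n) _ _ fun i hi => singularValue_of_cols_le A hi]
  conv_lhs => rw [h.2.2]
  rw [Matrix.conjTranspose_mul, Matrix.conjTranspose_mul, Matrix.conjTranspose_conjTranspose,
    rectDiag_conjTranspose]
  simp only [Matrix.mul_assoc]
  rw [← Matrix.mul_assoc Vᴴ, h.conjTranspose_mul_right, Matrix.one_mul]

/-- A matrix enlarges the Gram determinant of `k` vectors at most by the product of its `k` largest
squared singular values. -/
theorem det_gram_mul_le {k : ℕ} (A : Matrix (Fin m) (Fin n) ℂ) (W : Matrix (Fin n) (Fin k) ℂ) :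
    ((A * W)ᴴ * (A * W)).det.re ≤
      (∏ i ∈ Finset.range k, singularValue A i ^ 2) * (Wᴴ * W).det.re := by
  obtain ⟨U, V, h⟩ := exists_isSVD A
  have h1 := det_conjTranspose_mul_diagonal_mul_le (singularValue_sq_antitone A)
    (fun i => sq_nonneg _) (Vᴴ * W)
  have h2 : (Vᴴ * W)ᴴ * (Vᴴ * W) = Wᴴ * W := by
    rw [Matrix.conjTranspose_mul, Matrix.conjTranspose_conjTranspose, Matrix.mul_assoc,
      ← Matrix.mul_assoc V, h.mul_conjTranspose_right, Matrix.one_mul]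
  have h3 : (A * W)ᴴ * (A * W) = (Vᴴ * W)ᴴ *
      Matrix.diagonal (fun j : Fin n => ((singularValue A j ^ 2 : ℝ) : ℂ)) * (Vᴴ * W) := by
    rw [Matrix.conjTranspose_mul, Matrix.mul_assoc, ← Matrix.mul_assoc Aᴴ, h.conjTranspose_mul_self,
      Matrix.conjTranspose_mul, Matrix.conjTranspose_conjTranspose]
    simp only [Matrix.mul_assoc]
  rw [h2] at h1
  rw [h3]
  exact h1

/-- The product of the `k` largest squared singular values is the Gram determinant of the images
of `k` orthonormal vectors. -/
theorem exists_det_gram_eq (A : Matrix (Fin m) (Fin n) ℂ) {k : ℕ} (hk : k ≤ n) :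
    ∃ W : Matrix (Fin n) (Fin k) ℂ, Wᴴ * W = 1 ∧
      ((A * W)ᴴ * (A * W)).det.re = ∏ i ∈ Finset.range k, singularValue A i ^ 2 := by
  obtain ⟨U, V, h⟩ := exists_isSVD A
  let c := Fin.castLE hk
  have hc : Function.Injective c := Fin.castLE_injective hk
  -- The first `k` right singular vectors.
  refine ⟨V.submatrix id c, ?_, ?_⟩
  · have : (V.submatrix id c)ᴴ * V.submatrix id c = (Vᴴ * V).submatrix c c := by
      rw [Matrix.conjTranspose_submatrix, ← Matrix.submatrix_mul _ _ _ _ _ Function.bijective_id]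
    rw [this, h.conjTranspose_mul_right, Matrix.submatrix_one _ hc]
  · have h1 : A * V.submatrix id c = (A * V).submatrix id c := by
      rw [Matrix.submatrix_mul _ _ _ id _ Function.bijective_id, Matrix.submatrix_id_id]
    have h2 : (A * V)ᴴ * (A * V) =
        Matrix.diagonal (fun j : Fin n => ((singularValue A j ^ 2 : ℝ) : ℂ)) := by
      rw [Matrix.conjTranspose_mul, Matrix.mul_assoc, ← Matrix.mul_assoc Aᴴ,
        h.conjTranspose_mul_self]
      simp only [Matrix.mul_assoc]
      rw [h.conjTranspose_mul_right, Matrix.mul_one, ← Matrix.mul_assoc,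
        h.conjTranspose_mul_right, Matrix.one_mul]
    rw [h1, Matrix.conjTranspose_submatrix,
      ← Matrix.submatrix_mul _ _ _ _ _ Function.bijective_id, h2, Matrix.submatrix_diagonal _ _ hc,
      Matrix.det_diagonal, ← Fin.prod_univ_eq_prod_range (fun i => singularValue A i ^ 2)]
    simp only [Function.comp_apply, ← Complex.ofReal_prod, Complex.ofReal_re]
    rfl

end SingularValues

/-- The determinant has `M` factors; those with index at least `N` equal `1`, which leaves `min N M`
modes. -/
theorem rate_eq_sum {M N : ℕ} {σn : ℝ} {H : Matrix (Fin M) (Fin N) ℂ} {Q : Matrix (Fin N) (Fin N) ℂ}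
    {U : Matrix (Fin M) (Fin M) ℂ} {d : ℕ → ℝ} (hU : U * Uᴴ = 1) (hd0 : ∀ i, 0 ≤ d i)
    (hdN : ∀ i, N ≤ i → d i = 0)
    (h : H * Q * Hᴴ = U * Matrix.diagonal (fun j : Fin M => ((d j : ℝ) : ℂ)) * Uᴴ) :
    rate σn H Q = ∑ i ∈ Finset.range (min N M), Real.log (1 + d i / σn ^ 2) := by
  have h1 : 1 + (((σn ^ 2)⁻¹ : ℝ) : ℂ) • (H * Q * Hᴴ) =
      U * Matrix.diagonal (fun j : Fin M => ((1 + d j / σn ^ 2 : ℝ) : ℂ)) * Uᴴ := by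
    have h2 : Matrix.diagonal (fun j : Fin M => ((1 + d j / σn ^ 2 : ℝ) : ℂ)) =
        1 + (((σn ^ 2)⁻¹ : ℝ) : ℂ) • Matrix.diagonal (fun j : Fin M => ((d j : ℝ) : ℂ)) := by
      ext i j
      by_cases hij : i = j
      · subst hij
        simp [div_eq_inv_mul]
      · simp [hij]
    rw [h, h2, Matrix.mul_add, Matrix.add_mul, Matrix.mul_one, hU, Matrix.mul_smul,
      Matrix.smul_mul]
  have h3 : (1 + (((σn ^ 2)⁻¹ : ℝ) : ℂ) • (H * Q * Hᴴ)).det.re =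
      ∏ i ∈ Finset.range M, (1 + d i / σn ^ 2) := by
    rw [h1, Matrix.det_mul, mul_comm, ← Matrix.det_mul, ← Matrix.mul_assoc,
      mul_eq_one_comm.1 hU, Matrix.one_mul, Matrix.det_diagonal, ← Complex.ofReal_prod,
      Complex.ofReal_re, Fin.prod_univ_eq_prod_range (fun i => 1 + d i / σn ^ 2)]
  have hpos : ∀ i, 1 + d i / σn ^ 2 ≠ 0 := fun i => by
    have := div_nonneg (hd0 i) (sq_nonneg σn)
    linarith
  rw [rate, h3, Real.log_prod fun i _ => hpos i]
  refine (Finset.sum_subset (Finset.range_subset_range.2 (min_le_right _ _)) fun i hi hi' => ?_).symm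
  have hN : N ≤ i := by
    simp only [Finset.mem_range] at hi hi'
    omega
  simp [hdN i hN]

/-! ### Achievability and converse for the channel -/

section Channel

variable {N M K : ℕ} (HF : Matrix (Fin K) (Fin N) ℂ) (HB : Matrix (Fin M) (Fin K) ℂ)

theorem gain_nonneg (i : ℕ) : 0 ≤ gain HF HB i :=
  mul_nonneg (sq_nonneg _) (sq_nonneg _)

theorem waterPower_nonneg (σn μ : ℝ) (i : ℕ) : 0 ≤ waterPower σn HF HB μ i :=
  waterFill_nonneg _ _ _ _

theorem gain_of_le {i : ℕ} (hi : min N M ≤ i) : gain HF HB i = 0 := by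
  rcases min_le_iff.1 hi with h | h
  · simp [gain, singularValue_of_cols_le HF h]
  · simp [gain, singularValue_of_rows_le HB h]

theorem waterPower_of_le (σn μ : ℝ) {i : ℕ} (hi : min N M ≤ i) : waterPower σn HF HB μ i = 0 := by
  simp [waterPower, gain_of_le HF HB hi]

variable {HF HB}

theorem feasible_covariance {V : Matrix (Fin N) (Fin N) ℂ} {Φ : Matrix (Fin K) (Fin K) ℂ} {P : ℝ}
    {p : ℕ → ℝ} (hV : V ∈ Matrix.unitaryGroup (Fin N) ℂ) (hΦ : Φ ∈ Matrix.unitaryGroup (Fin K) ℂ)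
    (hp : ∀ i, 0 ≤ p i) (hP : ∑ i ∈ Finset.range N, p i ≤ P) :
    Feasible P (covariance V p) Φ := by
  refine ⟨?_, ?_, hΦ⟩
  · refine Matrix.PosSemidef.mul_mul_conjTranspose_same (Matrix.PosSemidef.diagonal fun j => ?_) V
    exact Complex.zero_le_real.2 (hp j)
  · rw [covariance, Matrix.trace_mul_comm, ← Matrix.mul_assoc, ← Matrix.star_eq_conjTranspose,
      Matrix.mem_unitaryGroup_iff'.1 hV, Matrix.one_mul, Matrix.trace_diagonal,
      ← Complex.ofReal_sum, Complex.ofReal_re, Fin.sum_univ_eq_sum_range]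
    exact hP

/-- Aligning the right singular vectors of `HB` with the left singular vectors of `HF` turns the
channel into parallel modes. -/
theorem channel_mul_covariance_mul {UF : Matrix (Fin K) (Fin K) ℂ} {VF : Matrix (Fin N) (Fin N) ℂ}
    {UB : Matrix (Fin M) (Fin M) ℂ} {VB : Matrix (Fin K) (Fin K) ℂ} (hF : IsSVD HF UF VF)
    (hB : IsSVD HB UB VB) (p : ℕ → ℝ) :
    HB * (VB * UFᴴ) * HF * covariance VF p * (HB * (VB * UFᴴ) * HF)ᴴ =
      UB * Matrix.diagonal (fun j : Fin M => ((gain HF HB j * p j : ℝ) : ℂ)) * UBᴴ := by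
  set b := singularValue HB
  set f := singularValue HF
  have hH : HB * (VB * UFᴴ) * HF = UB * rectDiag M N (fun i => b i * f i) * VFᴴ := by
    rw [← rectDiag_mul (m := K) _ _ fun i hi => singularValue_of_cols_le HB hi]
    conv_lhs => rw [hB.2.2, hF.2.2]
    simp only [Matrix.mul_assoc]
    rw [← Matrix.mul_assoc VBᴴ, hB.conjTranspose_mul_right, Matrix.one_mul,
      ← Matrix.mul_assoc UFᴴ, hF.conjTranspose_mul_left, Matrix.one_mul]
  have hD : (fun j : Fin M => ((gain HF HB j * p j : ℝ) : ℂ)) =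
      fun j : Fin M => (((b j * f j) * (p j * (b j * f j)) : ℝ) : ℂ) := by
    funext j
    congr 1
    simp only [gain, b, f]
    ring
  have hz : ∀ i, N ≤ i → b i * f i = 0 := fun i hi => by
    simp [f, singularValue_of_cols_le HF hi]
  rw [hD, ← rectDiag_self fun i => (b i * f i) * (p i * (b i * f i)),
    ← rectDiag_mul (m := N) (fun i => b i * f i) _ hz, hH, covariance, ← rectDiag_self p,
    Matrix.conjTranspose_mul, Matrix.conjTranspose_mul, Matrix.conjTranspose_conjTranspose,
    rectDiag_conjTranspose]
  simp only [Matrix.mul_assoc]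
  rw [← Matrix.mul_assoc VFᴴ, hF.conjTranspose_mul_right, Matrix.one_mul,
    ← Matrix.mul_assoc VFᴴ, hF.conjTranspose_mul_right, Matrix.one_mul,
    ← Matrix.mul_assoc (rectDiag N N p)]
  congr 3
  ext i j
  rw [rectDiag_self p, Matrix.diagonal_mul]
  simp only [rectDiag, Matrix.of_apply]
  split_ifs with h
  · push_cast
    ring
  · simp

theorem rate_covariance {UF : Matrix (Fin K) (Fin K) ℂ} {VF : Matrix (Fin N) (Fin N) ℂ}
    {UB : Matrix (Fin M) (Fin M) ℂ} {VB : Matrix (Fin K) (Fin K) ℂ} (hF : IsSVD HF UF VF)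
    (hB : IsSVD HB UB VB) (σn : ℝ) {p : ℕ → ℝ} (hp : ∀ i, 0 ≤ p i) :
    rate σn (HB * (VB * UFᴴ) * HF) (covariance VF p) =
      ∑ i ∈ Finset.range (min N M), Real.log (1 + gain HF HB i * (p i / σn ^ 2)) := by
  rw [rate_eq_sum hB.mul_conjTranspose_left (fun i => mul_nonneg (gain_nonneg HF HB i) (hp i))
    (fun i hi => by rw [gain_of_le HF HB (min_le_of_left_le hi), zero_mul])
    (channel_mul_covariance_mul hF hB p)]
  simp only [mul_div_assoc]

/-- Horn's inequality for a chain of factors, one of which is unitary. -/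
theorem prod_singularValue_sq_le {Φ : Matrix (Fin K) (Fin K) ℂ}
    (hΦ : Φ ∈ Matrix.unitaryGroup (Fin K) ℂ) (S : Matrix (Fin N) (Fin N) ℂ) {k : ℕ} (hk : k ≤ N) :
    ∏ i ∈ Finset.range k, singularValue (HB * Φ * HF * S) i ^ 2 ≤
      ∏ i ∈ Finset.range k, gain HF HB i * singularValue S i ^ 2 := by
  -- Vectors extremal for the whole product are followed through its factors: each factor costs at
  -- most its own singular value product, and `Φ` preserves the Gram matrix.
  obtain ⟨W, hW, h⟩ := exists_det_gram_eq (HB * Φ * HF * S) hk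
  have hB := det_gram_mul_le HB (Φ * (HF * (S * W)))
  have hU : (Φ * (HF * (S * W)))ᴴ * (Φ * (HF * (S * W))) =
      (HF * (S * W))ᴴ * (HF * (S * W)) := by
    rw [Matrix.conjTranspose_mul, Matrix.mul_assoc, ← Matrix.mul_assoc Φᴴ,
      ← Matrix.star_eq_conjTranspose Φ, Matrix.mem_unitaryGroup_iff'.1 hΦ, Matrix.one_mul]
  have hF := det_gram_mul_le HF (S * W)
  have hS := det_gram_mul_le S W
  rw [hW, Matrix.det_one, Complex.one_re, mul_one] at hS
  have hpB : 0 ≤ ∏ i ∈ Finset.range k, singularValue HB i ^ 2 :=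
    Finset.prod_nonneg fun _ _ => sq_nonneg _
  have hpF : 0 ≤ ∏ i ∈ Finset.range k, singularValue HF i ^ 2 :=
    Finset.prod_nonneg fun _ _ => sq_nonneg _
  rw [hU] at hB
  rw [← h]
  simp only [gain, Finset.prod_mul_distrib]
  calc _ = ((HB * (Φ * (HF * (S * W))))ᴴ * (HB * (Φ * (HF * (S * W))))).det.re := by
        simp only [Matrix.mul_assoc]
    _ ≤ _ := hB.trans (mul_le_mul_of_nonneg_left
        (hF.trans (mul_le_mul_of_nonneg_left hS hpF)) hpB)
    _ = _ := by ring

theorem rate_le_sum {σn P : ℝ} {Q : Matrix (Fin N) (Fin N) ℂ} {Φ : Matrix (Fin K) (Fin K) ℂ}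
    (hσ : 0 < σn) (h : Feasible P Q Φ) :
    ∃ q : ℕ → ℝ, (∀ i, 0 ≤ q i) ∧ ∑ i ∈ Finset.range N, q i ≤ P ∧
      rate σn (HB * Φ * HF) Q ≤
        ∑ i ∈ Finset.range (min N M), Real.log (1 + gain HF HB i * (q i / σn ^ 2)) := by
  obtain ⟨hQ, htr, hΦ⟩ := h
  obtain ⟨S, rfl⟩ : ∃ S : Matrix (Fin N) (Fin N) ℂ, Q = S * Sᴴ := by
    open scoped MatrixOrder in
    obtain ⟨B, hB⟩ := CStarAlgebra.nonneg_iff_eq_star_mul_self.mp hQ.nonneg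
    exact ⟨Bᴴ, by rw [hB, Matrix.conjTranspose_conjTranspose]; rfl⟩
  -- These are the eigenvalues of `S Sᴴ`, so they sum to its trace.
  refine ⟨fun i => singularValue S i ^ 2, fun _ => sq_nonneg _, ?_, ?_⟩
  · obtain ⟨U, V, hS⟩ := exists_isSVD S
    rw [hS.mul_conjTranspose_self, Matrix.trace_mul_comm, ← Matrix.mul_assoc,
      hS.conjTranspose_mul_left, Matrix.one_mul, Matrix.trace_diagonal,
      ← Complex.ofReal_sum, Complex.ofReal_re,
      Fin.sum_univ_eq_sum_range (fun i => singularValue S i ^ 2)] at htr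
    exact htr
  · set A := HB * Φ * HF * S with hA
    obtain ⟨U, V, hSVD⟩ := exists_isSVD A
    have hAA : HB * Φ * HF * (S * Sᴴ) * (HB * Φ * HF)ᴴ = A * Aᴴ := by
      rw [hA, Matrix.conjTranspose_mul (HB * Φ * HF) S]
      simp only [Matrix.mul_assoc]
    rw [rate_eq_sum hSVD.mul_conjTranspose_left (fun i => sq_nonneg (singularValue A i))
      (fun i hi => by rw [singularValue_of_cols_le A hi]; simp)
      (hAA.trans hSVD.mul_conjTranspose_self)]
    have hs : 0 < σn ^ 2 := by positivity
    refine sum_log_one_add_le_of_prod_le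
      (fun i j hij => div_le_div_of_nonneg_right (singularValue_sq_antitone A hij) hs.le)
      (fun i => by positivity) (fun i => mul_nonneg (gain_nonneg HF HB i) (by positivity)) _
      fun k hk => ?_
    simp only [← mul_div_assoc, Finset.prod_div_distrib]
    exact div_le_div_of_nonneg_right
      (prod_singularValue_sq_le hΦ S (hk.trans (min_le_left _ _)))
      (Finset.prod_nonneg fun _ _ => hs.le)

end Channel

end RISMIMO

theorem proposition1 (N M K : ℕ) (HF : Matrix (Fin K) (Fin N) ℂ) (HB : Matrix (Fin M) (Fin K) ℂ)
    (hF : HF ≠ 0) (hB : HB ≠ 0) (σn P : ℝ) (hσ : 0 < σn) (hP : 0 ≤ P) :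
    (∃ μ : ℝ, ∑ i ∈ Finset.range (min N M), RISMIMO.waterPower σn HF HB μ i = P) ∧
    ∀ μ : ℝ, ∑ i ∈ Finset.range (min N M), RISMIMO.waterPower σn HF HB μ i = P →
      IsGreatest (RISMIMO.achievableRates σn P HF HB)
        (∑ i ∈ Finset.range (min N M),
          Real.log (1 + RISMIMO.singularValue HF i ^ 2 * RISMIMO.singularValue HB i ^ 2 *
            (RISMIMO.waterPower σn HF HB μ i / σn ^ 2))) ∧
      ∀ (UF : Matrix (Fin K) (Fin K) ℂ) (VF : Matrix (Fin N) (Fin N) ℂ)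
        (UB : Matrix (Fin M) (Fin M) ℂ) (VB : Matrix (Fin K) (Fin K) ℂ),
        RISMIMO.IsSVD HF UF VF → RISMIMO.IsSVD HB UB VB →
          RISMIMO.Feasible P (RISMIMO.covariance VF (RISMIMO.waterPower σn HF HB μ)) (VB * UFᴴ) ∧
          RISMIMO.rate σn (HB * (VB * UFᴴ) * HF)
              (RISMIMO.covariance VF (RISMIMO.waterPower σn HF HB μ)) =
            ∑ i ∈ Finset.range (min N M),
              Real.log (1 + RISMIMO.singularValue HF i ^ 2 * RISMIMO.singularValue HB i ^ 2 *
                (RISMIMO.waterPower σn HF HB μ i / σn ^ 2)) := by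
  have hN : 0 < N := Nat.pos_of_ne_zero fun h => hF (by subst h; ext i j; exact j.elim0)
  have hM : 0 < M := Nat.pos_of_ne_zero fun h => hB (by subst h; ext i j; exact i.elim0)
  have hs : 0 < σn ^ 2 := by positivity
  refine ⟨RISMIMO.exists_sum_waterFill_eq hs hP (RISMIMO.gain_nonneg HF HB) (lt_min hN hM)
    (mul_pos (pow_pos (RISMIMO.singularValue_zero_pos hF) 2)
      (pow_pos (RISMIMO.singularValue_zero_pos hB) 2)), fun μ hμ => ?_⟩
  -- The covariance has `N` diagonal powers, but those beyond `min N M` belong to zero gains and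
  -- cost nothing.
  have hsum : ∑ i ∈ Finset.range N, RISMIMO.waterPower σn HF HB μ i ≤ P := by
    rw [← hμ]
    refine (Finset.sum_subset (Finset.range_subset_range.2 (min_le_left _ _))
      fun i _ hi => ?_).ge
    exact RISMIMO.waterPower_of_le HF HB σn μ (not_lt.1 fun h => hi (Finset.mem_range.2 h))
  have hopt : ∀ (UF : Matrix (Fin K) (Fin K) ℂ) (VF : Matrix (Fin N) (Fin N) ℂ)
      (UB : Matrix (Fin M) (Fin M) ℂ) (VB : Matrix (Fin K) (Fin K) ℂ),
      RISMIMO.IsSVD HF UF VF → RISMIMO.IsSVD HB UB VB →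
      RISMIMO.Feasible P (RISMIMO.covariance VF (RISMIMO.waterPower σn HF HB μ)) (VB * UFᴴ) ∧
      RISMIMO.rate σn (HB * (VB * UFᴴ) * HF)
          (RISMIMO.covariance VF (RISMIMO.waterPower σn HF HB μ)) =
        ∑ i ∈ Finset.range (min N M),
          Real.log (1 + RISMIMO.singularValue HF i ^ 2 * RISMIMO.singularValue HB i ^ 2 *
            (RISMIMO.waterPower σn HF HB μ i / σn ^ 2)) := fun UF VF UB VB h1 h2 =>
    ⟨RISMIMO.feasible_covariance h1.2.1 (mul_mem h2.2.1 (Unitary.star_mem h1.1))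
      (RISMIMO.waterPower_nonneg HF HB σn μ) hsum,
      RISMIMO.rate_covariance h1 h2 σn (RISMIMO.waterPower_nonneg HF HB σn μ)⟩
  refine ⟨⟨?_, ?_⟩, hopt⟩
  · obtain ⟨UF, VF, h1⟩ := RISMIMO.exists_isSVD HF
    obtain ⟨UB, VB, h2⟩ := RISMIMO.exists_isSVD HB
    obtain ⟨hfeas, hrate⟩ := hopt UF VF UB VB h1 h2
    exact ⟨_, _, hfeas, hrate.symm⟩
  · rintro r ⟨Q, Φ, hfeas, rfl⟩
    obtain ⟨q, hq, hqP, hle⟩ := RISMIMO.rate_le_sum (HF := HF) (HB := HB) hσ hfeas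
    refine hle.trans (RISMIMO.sum_log_le_sum_log_waterFill hs (RISMIMO.gain_nonneg HF HB) hq
      (le_trans ?_ hqP) hμ)
    exact Finset.sum_le_sum_of_subset_of_nonneg (Finset.range_subset_range.2 (min_le_left _ _))
      fun i _ _ => hq i
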